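/- **Theorem 3.2 (Asymptotic convergence).** Let $m\ge 0$, $L\ge 0$ and $K,J,N\ge 1$ be integers. Let $h_1,\dots,h_L\in\mathbb{R}[\boldsymbol{\xi}]$, $\boldsymbol{\xi}=(\xi_1,\dots,\xi_m)$, and $\Xi=\{\boldsymbol{\xi}\in\mathbb{R}^m : h_\ell(\boldsymbol{\xi})\ge 0,\ \ell=1,\dots,L\}$. Assume that $\Xi$ is convex and that $h_1,\dots,h_L$ satisfy the Archimedean condition: for some $R\in\mathbb{N}$ the polynomial $R-\|\boldsymbol{\xi}\|_2^2$ can be written as $\sigma_0+\sum_{\ell=1}^L\sigma_\ell h_\ell$ with sums of squares of polynomials $\sigma_0,\dots,\sigma_L\in\mathbb{R}[\boldsymbol{\xi}]$ (in particular $\Xi$ is compact). Let $\widehat{\boldsymbol{\xi}}_1,\dots,\widehat{\boldsymbol{\xi}}_N\in\Xi$, let $\widehat{\mathbb{P}}=\frac1N\sum_{i=1}^N\delta_{\widehat{\boldsymbol{\xi}}_i}$, let $\varepsilon>0$, and let $\mathbb{B}_\varepsilon(\widehat{\mathbb{P}})$ be the set of all Borel probability measures $\mathbb{Q}$ on $\Xi$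 with $d_W(\mathbb{Q},\widehat{\mathbb{P}})\le\varepsilon$, where $d_W$ is the Wasserstein distance of order $2$ on $\Xi$ for the Euclidean norm. Let $g_j^{(k)}\in\mathbb{R}[\boldsymbol{\xi}]$ for $1\le k\le K$, $1\le j\le J$, and let $\tau_1^{(k)},\tau_2^{(k)}\in\mathbb{R}$ satisfy $$\max_{\boldsymbol{\xi}\in\Xi}\max_{1\le j\le J} g_j^{(k)}(\boldsymbol{\xi})<\tau_1^{(k)},\qquad \tau_2^{(k)}<\min_{\boldsymbol{\xi}\in\Xi}\min_{1\le j\le J} g_j^{(k)}(\boldsymbol{\xi})\qquad(1\le k\le K).$$ With an additional variable $\widetilde{\xi}$, let $\Sigma^2$ be the set of sums of squares of polynomials in $\mathbb{R}[\boldsymbol{\xi},\widetilde{\xi}]$, and $\Sigma^2_{2r}$ the set of those of degree at most $2r$. Put $\widetilde g_j^{(k)}=\widetilde{\xi}-g_j^{(k)}(\boldsymbol{\xi})$ for $1\le j\le J$, $\widetilde g_{J+1}^{(k)}=\tau_1^{(k)}-\widetilde{\xi}$ and $\widetilde g_{J+2}^{(k)}=\widetilde{\xi}-\tau_2^{(k)}$.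 For $r\in\mathbb{N}$ let $v_r\in[-\infty,+\infty]$ be the optimal value of the program $(\mathrm{AD}_r)$, that is, the supremum of $$-\lambda\varepsilon^2+\frac1N\sum_{i=1}^N\alpha_i$$ over all $\lambda\ge0$, $\alpha_i\in\mathbb{R}$ and $\sigma_{\ell,i}^{(k)},\eta_{j,i}^{(k)}\in\Sigma^2$ ($1\le i\le N$, $1\le k\le K$, $1\le\ell\le L$, $1\le j\le J+2$) such that, for all such $i,k,\ell,j$, $$\widetilde{\xi}+\lambda\|\boldsymbol{\xi}-\widehat{\boldsymbol{\xi}}_i\|_2^2-\alpha_i-\sum_{\ell=1}^L\sigma_{\ell,i}^{(k)}h_\ell-\sum_{j=1}^{J+2}\eta_{j,i}^{(k)}\widetilde g_j^{(k)}\in\Sigma^2_{2r},\qquad \deg\big(\sigma_{\ell,i}^{(k)}h_\ell\big)\le2r,\quad \deg\big(\eta_{j,i}^{(k)}\widetilde g_j^{(k)}\big)\le2r,$$ with $v_r=-\infty$ if no such choice exists. Then the minimum $$v=\min_{\mathbb{Q}\in\mathbb{B}_\varepsilon(\widehat{\mathbb{P}})}\ \mathbb{E}^{\mathbb{Q}}\Big[\min_{1\le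 k\le K}\ \max_{1\le j\le J}\ g_j^{(k)}(\boldsymbol{\xi})\Big]$$ is attained, $v_r\le v_{r+1}\le v$ for all $r\in\mathbb{N}$, and $\lim_{r\to\infty}v_r=v$. -/

import Mathlib

open MeasureTheory Filter Topology
open scoped ENNReal

noncomputable section

namespace WassersteinSOS

variable {m L K J N : ℕ}

/-- The basic semi-algebraic set `Ξ = {ξ ∈ ℝᵐ : h_ℓ(ξ) ≥ 0 for all ℓ}`. -/
def supportSet (h : Fin L → MvPolynomial (Fin m) ℝ) : Set (EuclideanSpace ℝ (Fin m)) :=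
  {ξ | ∀ l, 0 ≤ MvPolynomial.eval ξ.ofLp (h l)}

/-- The quadratic module `Q(h₁, …, h_L)`: all `σ₀ + ∑ σ_ℓ h_ℓ` with `σ₀, …, σ_L` sums of
squares of polynomials. -/
def quadraticModule (h : Fin L → MvPolynomial (Fin m) ℝ) : Set (MvPolynomial (Fin m) ℝ) :=
  {f | ∃ (σ₀ : MvPolynomial (Fin m) ℝ) (σ : Fin L → MvPolynomial (Fin m) ℝ),
    IsSumSq σ₀ ∧ (∀ l, IsSumSq (σ l)) ∧ f = σ₀ + ∑ l, σ l * h l}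

/-- The Archimedean condition: `R - ‖ξ‖₂²` lies in the quadratic module for some `R ∈ ℕ`. -/
def IsArchimedean (h : Fin L → MvPolynomial (Fin m) ℝ) : Prop :=
  ∃ R : ℕ, MvPolynomial.C (R : ℝ) - ∑ a, MvPolynomial.X a ^ 2 ∈ quadraticModule h

/-- The piecewise polynomial `ξ ↦ min_k max_j g_j^{(k)}(ξ)`. -/
def piecewisePoly [NeZero K] [NeZero J] (g : Fin K → Fin J → MvPolynomial (Fin m) ℝ)
    (ξ : EuclideanSpace ℝ (Fin m)) : ℝ :=
  Finset.univ.inf' Finset.univ_nonempty fun k : Fin K =>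
    Finset.univ.sup' Finset.univ_nonempty fun j : Fin J => MvPolynomial.eval ξ.ofLp (g k j)

/-! ### The Wasserstein ball -/

/-- Joint distributions on `Ξ × Ξ` with first marginal `Q` and second marginal `P`. -/
def couplings {Ξ : Set (EuclideanSpace ℝ (Fin m))} (Q P : Measure Ξ) : Set (Measure (Ξ × Ξ)) :=
  {π | IsProbabilityMeasure π ∧ π.map Prod.fst = Q ∧ π.map Prod.snd = P}

/-- The Wasserstein distance of order 2, with the Euclidean norm as ground cost. -/
def wassersteinDist {Ξ : Set (EuclideanSpace ℝ (Fin m))} (Q P : Measure Ξ) : ℝ≥0∞ :=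
  ⨅ π ∈ couplings Q P,
    (∫⁻ z, ENNReal.ofReal (‖(z.1 : EuclideanSpace ℝ (Fin m)) - z.2‖ ^ 2) ∂π) ^ (1 / 2 : ℝ)

/-- The empirical distribution `(1/N) ∑ᵢ δ_{ξ̂ᵢ}`. -/
def empiricalMeasure {Ξ : Set (EuclideanSpace ℝ (Fin m))} (ξhat : Fin N → Ξ) : Measure Ξ :=
  (N : ℝ≥0∞)⁻¹ • ∑ i, Measure.dirac (ξhat i)

/-- The Wasserstein ball of radius `ε` around the empirical distribution, inside the set of all
Borel probability measures on `Ξ`. -/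
def wassersteinBall {Ξ : Set (EuclideanSpace ℝ (Fin m))} (ξhat : Fin N → Ξ) (ε : ℝ) :
    Set (ProbabilityMeasure Ξ) :=
  {Q | wassersteinDist (Q : Measure Ξ) (empiricalMeasure ξhat) ≤ ENNReal.ofReal ε}

/-! ### The lifted hierarchy -/

/-- Polynomials in the variables `(ξ, ξ̃)`; the variable `some a` is `ξ_a`, and `none` is `ξ̃`. -/
abbrev LiftedPoly (m : ℕ) : Type := MvPolynomial (Option (Fin m)) ℝ

/-- A polynomial in `ξ`, regarded as a polynomial in `(ξ, ξ̃)`. -/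
def lift (p : MvPolynomial (Fin m) ℝ) : LiftedPoly m := MvPolynomial.rename some p

/-- `ψ(ξ, ξ̃) = ξ̃`. -/
def psi : LiftedPoly m := MvPolynomial.X none

/-- `φ(ξ, ξ̃) = ‖ξ - x‖₂²`. -/
def phi (x : EuclideanSpace ℝ (Fin m)) : LiftedPoly m :=
  ∑ a, (MvPolynomial.X (some a) - MvPolynomial.C (x a)) ^ 2

/-- For a fixed `k`, the `J + 2` polynomials `ξ̃ - g_j(ξ)` (`j = 1, …, J`), `τ₁ - ξ̃`,
`ξ̃ - τ₂`. -/
def gTilde (g : Fin J → MvPolynomial (Fin m) ℝ) (τ₁ τ₂ : ℝ) : Fin (J + 2) → LiftedPoly m :=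
  Fin.append (fun j => MvPolynomial.X none - lift (g j))
    ![MvPolynomial.C τ₁ - MvPolynomial.X none, MvPolynomial.X none - MvPolynomial.C τ₂]

/-- The decision variables of the program at any level of the hierarchy. -/
structure ADPoint (m L K J N : ℕ) where
  lam : ℝ
  α : Fin N → ℝ
  σ : Fin K → Fin N → Fin L → LiftedPoly m
  η : Fin K → Fin N → Fin (J + 2) → LiftedPoly m

/-- The objective `-λ ε² + (1/N) ∑ᵢ αᵢ`. -/
def ADPoint.objective (ε : ℝ) (p : ADPoint m L K J N) : ℝ :=
  -p.lam * ε ^ 2 + (1 / (N : ℝ)) * ∑ i, p.α i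

/-- The left-hand side `ψ + λ φᵢ - αᵢ - ∑_ℓ σ_{ℓ,i}^{(k)} h_ℓ - ∑_j η_{j,i}^{(k)} g̃_j^{(k)}` of
the sum-of-squares constraint with index `(k, i)`. -/
def ADPoint.certificate (h : Fin L → MvPolynomial (Fin m) ℝ)
    (g : Fin K → Fin J → MvPolynomial (Fin m) ℝ) (τ₁ τ₂ : Fin K → ℝ)
    (ξhat : Fin N → supportSet h) (p : ADPoint m L K J N) (k : Fin K) (i : Fin N) :
    LiftedPoly m :=
  psi + MvPolynomial.C p.lam * phi (ξhat i : EuclideanSpace ℝ (Fin m)) - MvPolynomial.C (p.α i)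
    - ∑ l, p.σ k i l * lift (h l) - ∑ j, p.η k i j * gTilde (g k) (τ₁ k) (τ₂ k) j

/-- Feasibility for the program at level `r`. -/
structure ADPoint.IsFeasible (h : Fin L → MvPolynomial (Fin m) ℝ)
    (g : Fin K → Fin J → MvPolynomial (Fin m) ℝ) (τ₁ τ₂ : Fin K → ℝ)
    (ξhat : Fin N → supportSet h) (r : ℕ) (p : ADPoint m L K J N) : Prop where
  lam_nonneg : 0 ≤ p.lam
  σ_sos : ∀ k i l, IsSumSq (p.σ k i l)
  η_sos : ∀ k i j, IsSumSq (p.η k i j)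
  certificate_sos : ∀ k i, IsSumSq (p.certificate h g τ₁ τ₂ ξhat k i)
  certificate_deg : ∀ k i, (p.certificate h g τ₁ τ₂ ξhat k i).totalDegree ≤ 2 * r
  σ_deg : ∀ k i l, (p.σ k i l * lift (h l)).totalDegree ≤ 2 * r
  η_deg : ∀ k i j, (p.η k i j * gTilde (g k) (τ₁ k) (τ₂ k) j).totalDegree ≤ 2 * r

/-- The optimal value of the maximization program at level `r`, in the extended reals; it is
`-∞` if the program is infeasible. -/
def valAD (h : Fin L → MvPolynomial (Fin m) ℝ) (g : Fin K → Fin J → MvPolynomial (Fin m) ℝ)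
    (τ₁ τ₂ : Fin K → ℝ) (ξhat : Fin N → supportSet h) (ε : ℝ) (r : ℕ) : EReal :=
  sSup ((fun p : ADPoint m L K J N => (p.objective ε : EReal)) ''
    {p | p.IsFeasible h g τ₁ τ₂ ξhat r})

end WassersteinSOS

end

/-!
# Convergence of the sum-of-squares hierarchy over a Wasserstein ball

Write `f = min_k max_j g_j^{(k)}`. The worst-case expectation of `f` over the ball has the
Lagrangian dual `max -l ε² + (1/N) ∑ αᵢ` over `l ≥ 0` and `αᵢ ≤ min_Ξ (f + l ‖· - ξ̂ᵢ‖²)`. The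
proof combines duality for this pair of problems with a Positivstellensatz.

*Duality.* Integrating `αᵢ ≤ f + l ‖· - ξ̂ᵢ‖²` against a coupling gives weak duality
(`WassersteinSOS.dual_le_integral`). For strong duality it is enough to look at measures that move
each atom `ξ̂ᵢ` to a point `x i`: on the compact space of such `x` the problem has a single
constraint, and the smallest multiplier `l` with a feasible minimizer of the Lagrangian has two
minimizers whose mixture is feasible and satisfies complementary slackness
(`exists_multiplier_of_compact`). The resulting mixture of point masses is optimal, so the minimum
is attained without any compactness argument for measures
(`WassersteinSOS.exists_primal_dual_optimal`).

*Hierarchy.* A feasible point of a level gives a dual feasible `(l, α)`, on evaluating the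
certificate at `ξ̃ = f ξ` (`WassersteinSOS.ADPoint.IsFeasible.le_lagrangian`). Conversely, when `αᵢ`
is strictly below the Lagrangian, the polynomial `ξ̃ + l φᵢ - αᵢ` is positive wherever the lifted
constraints hold, so that Putinar's Positivstellensatz (`putinar_positivstellensatz`) makes the
point feasible at all large levels (`WassersteinSOS.eventually_isFeasible`).

*Positivstellensatz.* If `f` is outside an Archimedean quadratic module `M`, the M. Riesz extension
theorem gives a normalized functional that is nonnegative on `M` and nonpositive at `f`. Such
functionals form a compact convex set, and by the Krein-Milman theorem an extreme one minimizes the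
value at `f`. Extreme ones are multiplicative (`IsQuadraticModule.extreme_state_mul`), hence point
evaluations on polynomials.
-/

/-! ### Quadratic modules in commutative real algebras -/

section QuadraticModule

variable {A : Type*} [CommRing A]

/-- A subset of a commutative ring that contains `1` and is closed under addition and under
multiplication by squares. -/
structure IsQuadraticModule (M : Set A) : Prop where
  one_mem : 1 ∈ M
  add_mem : ∀ {a b}, a ∈ M → b ∈ M → a + b ∈ M
  mul_self_mul_mem : ∀ (b : A) {a}, a ∈ M → b * b * a ∈ M

namespace IsQuadraticModule

variable {M : Set A}

lemma mul_self_mem (hM : IsQuadraticModule M) (b : A) : b * b ∈ M := by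
  simpa using hM.mul_self_mul_mem b hM.one_mem

lemma zero_mem (hM : IsQuadraticModule M) : (0 : A) ∈ M := by
  simpa using hM.mul_self_mem 0

variable [Algebra ℝ A]

lemma smul_mem (hM : IsQuadraticModule M) {c : ℝ} (hc : 0 ≤ c) {a : A} (ha : a ∈ M) :
    c • a ∈ M := by
  have := hM.mul_self_mul_mem (algebraMap ℝ A (Real.sqrt c)) ha
  rwa [← map_mul, Real.mul_self_sqrt hc, ← Algebra.smul_def] at this

lemma algebraMap_mem (hM : IsQuadraticModule M) {c : ℝ} (hc : 0 ≤ c) :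
    algebraMap ℝ A c ∈ M := by
  rw [Algebra.algebraMap_eq_smul_one]
  exact hM.smul_mem hc hM.one_mem

lemma algebraMap_sub_mem_mono (hM : IsQuadraticModule M) {c d : ℝ} (hcd : c ≤ d) {a : A}
    (ha : algebraMap ℝ A c - a ∈ M) : algebraMap ℝ A d - a ∈ M := by
  have := hM.add_mem (hM.algebraMap_mem (sub_nonneg.2 hcd)) ha
  rw [map_sub] at this
  convert this using 1
  ring

/-- If `n ± a` lie in a quadratic module with `n > 0`, so does
`n² - a² = ((n + a)² (n - a) + (n - a)² (n + a)) / 2n`. -/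
lemma sq_sub_mul_self_mem (hM : IsQuadraticModule M) {n : ℝ} (hn : 0 < n) {a : A}
    (h₁ : algebraMap ℝ A n - a ∈ M) (h₂ : algebraMap ℝ A n + a ∈ M) :
    algebraMap ℝ A (n ^ 2) - a * a ∈ M := by
  set c := algebraMap ℝ A n
  have h := hM.smul_mem (inv_nonneg.2 (mul_nonneg zero_le_two hn.le))
    (hM.add_mem (hM.mul_self_mul_mem (c + a) h₁) (hM.mul_self_mul_mem (c - a) h₂))
  have e : (c + a) * (c + a) * (c - a) + (c - a) * (c - a) * (c + a)
      = (2 * n) • (algebraMap ℝ A (n ^ 2) - a * a) := by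
    rw [Algebra.smul_def, map_mul, map_pow, map_ofNat]
    ring
  rwa [e, inv_smul_smul₀ (by positivity)] at h

/-- If `n - a²` lies in a quadratic module, so do `n + 1/4 ± a = (n - a²) + (a ± 1/2)²`. -/
lemma add_quarter_sub_mem (hM : IsQuadraticModule M) {n : ℝ} {a : A}
    (h : algebraMap ℝ A n - a * a ∈ M) : algebraMap ℝ A (n + 1 / 4) - a ∈ M := by
  have := hM.add_mem h (hM.mul_self_mem (a - algebraMap ℝ A (1 / 2)))
  have e : algebraMap ℝ A (1 / 2) * algebraMap ℝ A (1 / 2) = algebraMap ℝ A (1 / 4) := by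
    rw [← map_mul]; norm_num
  have e' : algebraMap ℝ A (1 / 2) + algebraMap ℝ A (1 / 2) = 1 := by
    rw [← map_add, ← map_one (algebraMap ℝ A)]; norm_num
  convert this using 1
  rw [map_add]
  linear_combination a * e' - e

/-- The elements `a` with `n ± a` in a given quadratic module for some real `n` form a
subalgebra. -/
def boundedElements (hM : IsQuadraticModule M) : Subalgebra ℝ A where
  carrier := {a | ∃ n : ℝ, algebraMap ℝ A n - a ∈ M ∧ algebraMap ℝ A n + a ∈ M}
  algebraMap_mem' c := ⟨|c|, by
    rw [← map_sub]; exact hM.algebraMap_mem (sub_nonneg.2 (le_abs_self c)), by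
    rw [← map_add]; exact hM.algebraMap_mem (by linarith [neg_abs_le c])⟩
  add_mem' := by
    rintro a b ⟨n, h₁, h₂⟩ ⟨k, h₃, h₄⟩
    refine ⟨n + k, ?_, ?_⟩
    · convert hM.add_mem h₁ h₃ using 1; rw [map_add]; ring
    · convert hM.add_mem h₂ h₄ using 1; rw [map_add]; ring
  mul_mem' := by
    -- By polarization it suffices that squares of bounded elements are bounded above.
    have key : ∀ {a b : A}, (∃ n : ℝ, algebraMap ℝ A n - a ∈ M ∧ algebraMap ℝ A n + a ∈ M) →
        (∃ n : ℝ, algebraMap ℝ A n - b ∈ M ∧ algebraMap ℝ A n + b ∈ M) →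
        ∃ n : ℝ, algebraMap ℝ A n - a * b ∈ M := by
      rintro a b ⟨n, h₁, h₂⟩ ⟨k, h₃, h₄⟩
      have h₁' : algebraMap ℝ A (|n| + |k| + 1) - (a + b) ∈ M := by
        refine hM.algebraMap_sub_mem_mono (c := n + k)
          (by linarith [le_abs_self n, le_abs_self k]) ?_
        convert hM.add_mem h₁ h₃ using 1; rw [map_add]; ring
      have h₂' : algebraMap ℝ A (|n| + |k| + 1) + (a + b) ∈ M := by
        rw [← sub_neg_eq_add]
        refine hM.algebraMap_sub_mem_mono (c := n + k)
          (by linarith [le_abs_self n, le_abs_self k]) ?_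
        convert hM.add_mem h₂ h₄ using 1; rw [map_add]; ring
      have h := hM.smul_mem (c := 1 / 4) (by norm_num) (hM.add_mem
        (hM.sq_sub_mul_self_mem (by positivity) h₁' h₂') (hM.mul_self_mem (a - b)))
      refine ⟨1 / 4 * (|n| + |k| + 1) ^ 2, ?_⟩
      have e : algebraMap ℝ A (1 / 4) * 4 = 1 := by
        rw [← map_ofNat (algebraMap ℝ A) 4, ← map_mul, ← map_one (algebraMap ℝ A)]; norm_num
      convert h using 1
      rw [Algebra.smul_def, map_mul]
      linear_combination (a * b) * e
    rintro a b ha ⟨k, h₃, h₄⟩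
    obtain ⟨n₁, h₁⟩ := key ha ⟨k, h₃, h₄⟩
    obtain ⟨n₂, h₂⟩ := key (b := -b) ha
      ⟨k, by rwa [sub_neg_eq_add], by rwa [← sub_eq_add_neg]⟩
    refine ⟨max n₁ n₂, hM.algebraMap_sub_mem_mono (le_max_left _ _) h₁, ?_⟩
    have := hM.algebraMap_sub_mem_mono (le_max_right n₁ n₂) h₂
    rwa [mul_neg, sub_neg_eq_add] at this

lemma mem_boundedElements (hM : IsQuadraticModule M) {a : A} : a ∈ hM.boundedElements ↔
    ∃ n : ℝ, algebraMap ℝ A n - a ∈ M ∧ algebraMap ℝ A n + a ∈ M := Iff.rfl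

lemma mem_boundedElements_of_le_of_le (hM : IsQuadraticModule M) {a : A} {c d : ℝ}
    (hc : a - algebraMap ℝ A c ∈ M) (hd : algebraMap ℝ A d - a ∈ M) :
    a ∈ hM.boundedElements := by
  refine ⟨max d (-c), hM.algebraMap_sub_mem_mono (le_max_left _ _) hd, ?_⟩
  rw [← sub_neg_eq_add]
  refine hM.algebraMap_sub_mem_mono (le_max_right _ _) ?_
  rwa [map_neg, sub_neg_eq_add, neg_add_eq_sub]

lemma mem_boundedElements_of_sub_mul_self_mem (hM : IsQuadraticModule M) {a : A} {n : ℝ}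
    (h : algebraMap ℝ A n - a * a ∈ M) : a ∈ hM.boundedElements := by
  refine ⟨n + 1 / 4, hM.add_quarter_sub_mem h, ?_⟩
  rw [← sub_neg_eq_add]
  exact hM.add_quarter_sub_mem (by rwa [neg_mul_neg])

end IsQuadraticModule

variable [Algebra ℝ A]

/-! ### States and their extreme points -/

/-- The `ℝ`-linear functionals that are nonnegative on `M` and send `1` to `1`. They are encoded
as plain functions, so that their topology is that of pointwise convergence. -/
def stateSet (M : Set A) : Set (A → ℝ) :=
  {ℓ | IsLinearMap ℝ ℓ ∧ (∀ m ∈ M, 0 ≤ ℓ m) ∧ ℓ 1 = 1}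

variable {M : Set A}

lemma isClosed_stateSet (M : Set A) : IsClosed (stateSet M) := by
  have : stateSet M = (⋂ a, ⋂ b, {ℓ : A → ℝ | ℓ (a + b) = ℓ a + ℓ b}) ∩
      (⋂ c : ℝ, ⋂ a, {ℓ : A → ℝ | ℓ (c • a) = c • ℓ a}) ∩
      (⋂ m ∈ M, {ℓ : A → ℝ | 0 ≤ ℓ m}) ∩ {ℓ : A → ℝ | ℓ 1 = 1} := by
    ext ℓ
    simp only [stateSet, Set.mem_ofPred_eq, Set.mem_inter_iff, Set.mem_iInter]
    exact ⟨fun h => ⟨⟨⟨h.1.map_add, h.1.map_smul⟩, h.2.1⟩, h.2.2⟩,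
      fun h => ⟨⟨h.1.1.1, h.1.1.2⟩, h.1.2, h.2⟩⟩
  rw [this]
  refine (((isClosed_iInter fun a => isClosed_iInter fun b => ?_).inter
    (isClosed_iInter fun c => isClosed_iInter fun a => ?_)).inter
    (isClosed_biInter fun m _ => ?_)).inter ?_
  · exact isClosed_eq (continuous_apply _) ((continuous_apply a).add (continuous_apply b))
  · exact isClosed_eq (continuous_apply _) ((continuous_apply _).const_smul c)
  · exact isClosed_le continuous_const (continuous_apply _)
  · exact isClosed_eq (continuous_apply _) continuous_const

lemma state_le {ℓ : A → ℝ} (hℓ : IsLinearMap ℝ ℓ) (hpos : ∀ m ∈ M, 0 ≤ ℓ m) {a : A} {n : ℝ}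
    (h : algebraMap ℝ A n - a ∈ M) : ℓ a ≤ n * ℓ 1 := by
  have := hpos _ h
  rw [hℓ.map_sub, Algebra.algebraMap_eq_smul_one, hℓ.map_smul, smul_eq_mul] at this
  linarith

lemma isCompact_stateSet (harch : ∀ a : A, ∃ n : ℝ, algebraMap ℝ A n - a ∈ M) :
    IsCompact (stateSet M) := by
  choose n hn using harch
  refine (isCompact_univ_pi (s := fun a => Set.Icc (-(n (-a))) (n a))
    fun a => isCompact_Icc).of_isClosed_subset (isClosed_stateSet M) ?_
  rintro ℓ ⟨h₁, h₂, h₃⟩ a -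
  have k₁ := state_le h₁ h₂ (hn a)
  have k₂ := state_le h₁ h₂ (hn (-a))
  rw [h₁.map_neg] at k₂
  rw [h₃] at k₁ k₂
  exact ⟨by linarith, by linarith⟩

/-- A bounded sequence with `a n ^ 2 ≤ a 0 * a (2 * n)` has `a 1 ≤ a 0`: otherwise
`a (2 ^ k) ≥ a 0 * (a 1 / a 0) ^ (2 ^ k)` is unbounded. -/
lemma le_of_sq_le_mul_of_bounded {a : ℕ → ℝ} {B : ℝ} (h0 : 0 ≤ a 0) (hB : ∀ n, a n ≤ B)
    (hsq : ∀ n, a n ^ 2 ≤ a 0 * a (2 * n)) : a 1 ≤ a 0 := by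
  by_contra! hlt
  have hpos : 0 < a 0 := by
    rcases h0.lt_or_eq with h | h
    · exact h
    · have := hsq 1
      rw [← h] at this hlt
      nlinarith
  have hq : 1 < a 1 / a 0 := (one_lt_div hpos).2 hlt
  have hgrow : ∀ k : ℕ, a 0 * (a 1 / a 0) ^ (2 ^ k) ≤ a (2 ^ k) := by
    intro k
    induction k with
    | zero => simp [mul_div_cancel₀ _ hpos.ne']
    | succ k ih =>
      have h := hsq (2 ^ k)
      have h2 : (a 0 * (a 1 / a 0) ^ (2 ^ k)) ^ 2 ≤ a (2 ^ k) ^ 2 :=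
        pow_le_pow_left₀ (by positivity) ih 2
      rw [pow_succ' 2 k]
      refine le_of_mul_le_mul_left (le_trans (le_of_eq ?_) (h2.trans h)) hpos
      ring
  obtain ⟨k, hk⟩ := pow_unbounded_of_one_lt (B / a 0) hq
  have h1 : (a 1 / a 0) ^ k ≤ (a 1 / a 0) ^ (2 ^ k) :=
    pow_le_pow_right₀ hq.le (Nat.lt_two_pow_self).le
  have h2 := (div_lt_iff₀' hpos).1 (hk.trans_le h1)
  linarith [hgrow k, hB (2 ^ k)]

namespace IsQuadraticModule

/-- Although `(1 - b²) m` need not lie in the quadratic module when `1 - b²` and `m` do, states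
are nonnegative on it: `n ↦ ℓ (b²ⁿ m)` is bounded and satisfies the Cauchy-Schwarz inequality. -/
lemma state_mul_self_mul_le (hM : IsQuadraticModule M)
    (harch : ∀ a : A, ∃ n : ℝ, algebraMap ℝ A n - a ∈ M) {ℓ : A → ℝ} (hℓ : ℓ ∈ stateSet M)
    {b : A} (hb : 1 - b * b ∈ M) {m : A} (hm : m ∈ M) : ℓ (b * b * m) ≤ ℓ m := by
  obtain ⟨hlin, hpos, hone⟩ := hℓ
  have hpow : ∀ n : ℕ, ℓ ((b * b) ^ n) ≤ 1 := by
    intro n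
    induction n with
    | zero => simp [hone]
    | succ n ih =>
      have h := hpos _ (hM.mul_self_mul_mem (b ^ n) hb)
      have e : b ^ n * b ^ n * (1 - b * b) = (b * b) ^ n - (b * b) ^ (n + 1) := by ring
      rw [e, hlin.map_sub] at h
      linarith
  obtain ⟨B, hB⟩ := harch m
  have hB0 := hM.algebraMap_sub_mem_mono (le_abs_self B) hB
  have key := le_of_sq_le_mul_of_bounded (a := fun n => ℓ ((b * b) ^ n * m)) (B := |B|)
    (by simpa using hpos m hm) (fun n => ?_) (fun n => ?_)
  · simpa using key
  · have h := hpos _ (hM.mul_self_mul_mem (b ^ n) hB0)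
    have e : b ^ n * b ^ n * (algebraMap ℝ A |B| - m) = |B| • (b * b) ^ n - (b * b) ^ n * m := by
      rw [Algebra.smul_def]; ring
    rw [e, hlin.map_sub, hlin.map_smul, smul_eq_mul] at h
    have := mul_le_mul_of_nonneg_left (hpow n) (abs_nonneg B)
    linarith
  · have h : ∀ s : ℝ, 0 ≤ ℓ m * (s * s) + (-2 * ℓ ((b * b) ^ n * m)) * s
        + ℓ ((b * b) ^ (2 * n) * m) := by
      intro s
      have h := hpos _ (hM.mul_self_mul_mem ((b * b) ^ n - algebraMap ℝ A s) hm)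
      have e : ((b * b) ^ n - algebraMap ℝ A s) * ((b * b) ^ n - algebraMap ℝ A s) * m
          = (s * s) • m + (-2 * s) • ((b * b) ^ n * m) + (b * b) ^ (2 * n) * m := by
        simp only [Algebra.smul_def, map_mul, map_neg, map_ofNat]; ring
      rw [e, hlin.map_add, hlin.map_add, hlin.map_smul, hlin.map_smul, smul_eq_mul,
        smul_eq_mul] at h
      linarith
    have h' := discrim_le_zero h
    rw [discrim] at h'
    simp only [pow_zero, one_mul]
    nlinarith

lemma eq_zero_of_state_one_eq_zero
    (harch : ∀ a : A, ∃ n : ℝ, algebraMap ℝ A n - a ∈ M) {ℓ : A → ℝ} (hlin : IsLinearMap ℝ ℓ)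
    (hpos : ∀ m ∈ M, 0 ≤ ℓ m) (h1 : ℓ 1 = 0) (a : A) : ℓ a = 0 := by
  obtain ⟨n, hn⟩ := harch a
  obtain ⟨k, hk⟩ := harch (-a)
  have h₁ := state_le hlin hpos hn
  have h₂ := state_le hlin hpos hk
  rw [h1, mul_zero] at h₁ h₂
  rw [hlin.map_neg] at h₂
  linarith

/-- An extreme state `ℓ` satisfies `ℓ (b² x) = ℓ (b²) ℓ x` when `1 - b²` is in the quadratic
module, because `ℓ` is a convex combination of the normalizations of the positive functionals
`ℓ (b² ·)` and `ℓ ((1 - b²) ·)`. -/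
lemma extreme_state_mul_self_mul (hM : IsQuadraticModule M)
    (harch : ∀ a : A, ∃ n : ℝ, algebraMap ℝ A n - a ∈ M) {ℓ : A → ℝ}
    (hℓ : ℓ ∈ (stateSet M).extremePoints ℝ) {b : A} (hb : 1 - b * b ∈ M) (x : A) :
    ℓ (b * b * x) = ℓ (b * b) * ℓ x := by
  obtain ⟨hmem, hext⟩ := mem_extremePoints.1 hℓ
  have hlin := hmem.1
  have hpos := hmem.2.1
  have hone := hmem.2.2
  have lin₁ : IsLinearMap ℝ fun x => ℓ (b * b * x) :=
    ⟨fun x y => by rw [mul_add, hlin.map_add], fun c x => by rw [mul_smul_comm, hlin.map_smul]⟩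
  have lin₂ : IsLinearMap ℝ fun x => ℓ x - ℓ (b * b * x) :=
    ⟨fun x y => by simp only [hlin.map_add, lin₁.map_add]; ring,
      fun c x => by simp only [hlin.map_smul, lin₁.map_smul, smul_sub]⟩
  have pos₁ : ∀ m ∈ M, 0 ≤ ℓ (b * b * m) := fun m hm => hpos _ (hM.mul_self_mul_mem b hm)
  have pos₂ : ∀ m ∈ M, 0 ≤ ℓ m - ℓ (b * b * m) := fun m hm =>
    sub_nonneg.2 (hM.state_mul_self_mul_le harch hmem hb hm)
  have ht0 : 0 ≤ ℓ (b * b) := hpos _ (hM.mul_self_mem b)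
  have ht1 : ℓ (b * b) ≤ 1 := by
    have := pos₂ 1 hM.one_mem
    rw [hone, mul_one] at this
    linarith
  rcases ht0.eq_or_lt with h0 | h0
  · rw [← h0, zero_mul]
    exact eq_zero_of_state_one_eq_zero harch lin₁ pos₁ (by simp [← h0]) x
  rcases ht1.eq_or_lt with h1 | h1
  · have := eq_zero_of_state_one_eq_zero harch lin₂ pos₂ (by simp [h1, hone]) x
    rw [h1, one_mul]
    linarith
  set t := ℓ (b * b) with ht
  have h1' : 0 < 1 - t := sub_pos.2 h1
  have mem₁ : (fun x => t⁻¹ * ℓ (b * b * x)) ∈ stateSet M := by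
    refine ⟨⟨fun x y => ?_, fun c x => ?_⟩, fun m hm => ?_, ?_⟩
    · simp only [lin₁.map_add]; ring
    · simp only [lin₁.map_smul, smul_eq_mul]; ring
    · exact mul_nonneg (inv_nonneg.2 h0.le) (pos₁ m hm)
    · simp only [mul_one, ← ht, inv_mul_cancel₀ h0.ne']
  have mem₂ : (fun x => (1 - t)⁻¹ * (ℓ x - ℓ (b * b * x))) ∈ stateSet M := by
    refine ⟨⟨fun x y => ?_, fun c x => ?_⟩, fun m hm => ?_, ?_⟩
    · simp only [lin₂.map_add]; ring
    · simp only [lin₂.map_smul, smul_eq_mul]; ring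
    · exact mul_nonneg (inv_nonneg.2 h1'.le) (pos₂ m hm)
    · simp only [mul_one, ← ht, hone, inv_mul_cancel₀ h1'.ne']
  have hseg : ℓ ∈ openSegment ℝ (fun x => t⁻¹ * ℓ (b * b * x))
      (fun x => (1 - t)⁻¹ * (ℓ x - ℓ (b * b * x))) := by
    refine ⟨t, 1 - t, h0, h1', by ring, ?_⟩
    funext x
    simp only [Pi.add_apply, Pi.smul_apply, smul_eq_mul]
    field_simp
    ring
  have := congrFun (hext _ mem₁ _ mem₂ hseg).1 x
  field_simp at this
  linarith

/-- Extreme states of an Archimedean quadratic module are multiplicative. -/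
lemma extreme_state_mul (hM : IsQuadraticModule M)
    (harch : ∀ a : A, ∃ n : ℝ, algebraMap ℝ A n - a ∈ M) {ℓ : A → ℝ}
    (hℓ : ℓ ∈ (stateSet M).extremePoints ℝ) (x y : A) : ℓ (x * y) = ℓ x * ℓ y := by
  have hlin := (mem_extremePoints.1 hℓ).1.1
  have hsq : ∀ b x, ℓ (b * b * x) = ℓ (b * b) * ℓ x := by
    intro b x
    obtain ⟨n, hn⟩ := harch (b * b)
    -- Rescale `b` so that `1 - b²` lies in `M`.
    set s := |n| + 1
    have hs : 0 < s := by positivity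
    have hn' := hM.algebraMap_sub_mem_mono (d := s) (by linarith [le_abs_self n]) hn
    set c := Real.sqrt s⁻¹
    have hc : c * c = s⁻¹ := Real.mul_self_sqrt (inv_nonneg.2 hs.le)
    have hb : 1 - (c • b) * (c • b) ∈ M := by
      have := hM.smul_mem (inv_nonneg.2 hs.le) hn'
      rwa [smul_sub, Algebra.algebraMap_eq_smul_one, inv_smul_smul₀ hs.ne', ← hc, mul_smul,
        ← mul_smul_comm, ← smul_mul_assoc] at this
    have h := hM.extreme_state_mul_self_mul harch hℓ hb x
    have e : (c • b) * (c • b) = s⁻¹ • (b * b) := by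
      rw [smul_mul_smul_comm, hc]
    rw [e, smul_mul_assoc, hlin.map_smul, hlin.map_smul, smul_eq_mul, smul_eq_mul,
      mul_assoc s⁻¹] at h
    exact mul_left_cancel₀ (inv_ne_zero hs.ne') h
  have h₁ := hsq (x + 1) y
  have h₂ := hsq (x - 1) y
  have e : ∀ z, 4 * ℓ (x * z) = ℓ ((x + 1) * (x + 1) * z) - ℓ ((x - 1) * (x - 1) * z) := by
    intro z
    rw [← hlin.map_sub, ← smul_eq_mul, ← hlin.map_smul, Algebra.smul_def, map_ofNat]
    congr 1
    ring
  have e1 := e 1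
  have ey := e y
  simp only [mul_one] at e1
  rw [h₁, h₂, ← sub_mul, ← e1] at ey
  linarith

/-- **Representation theorem for Archimedean quadratic modules.** An element outside such a
module `M` is nonpositive at some real character that is nonnegative on `M`. -/
theorem exists_algHom_nonpos (hM : IsQuadraticModule M)
    (harch : ∀ a : A, ∃ n : ℝ, algebraMap ℝ A n - a ∈ M) {f : A} (hf : f ∉ M) :
    ∃ φ : A →ₐ[ℝ] ℝ, (∀ m ∈ M, 0 ≤ φ m) ∧ φ f ≤ 0 := by
  have hneg : (-1 : A) ∉ M := by
    intro h
    obtain ⟨n, hn⟩ := harch (-f)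
    have := hM.add_mem (hM.smul_mem (abs_nonneg n) h)
      (hM.algebraMap_sub_mem_mono (le_abs_self n) hn)
    rw [Algebra.algebraMap_eq_smul_one, smul_neg, sub_neg_eq_add, neg_add_cancel_left] at this
    exact hf this
  -- A state that is nonpositive at `f`, extended from `ℝ ⬝ 1` along the cone `M - ℝ≥0 f`.
  let s : PointedCone ℝ A :=
    { carrier := {a | ∃ c : ℝ, 0 ≤ c ∧ a + c • f ∈ M}
      zero_mem' := ⟨0, le_rfl, by simpa using hM.zero_mem⟩
      smul_mem' := by
        rintro ⟨t, ht⟩ a ⟨c, hc, h⟩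
        refine ⟨t * c, by positivity, ?_⟩
        rw [mul_smul, Nonneg.mk_smul, ← smul_add]
        exact hM.smul_mem ht h
      add_mem' := by
        rintro a b ⟨c, hc, h⟩ ⟨d, hd, h'⟩
        refine ⟨c + d, by positivity, ?_⟩
        rw [add_smul, add_add_add_comm]
        exact hM.add_mem h h' }
  have hs : ∀ t : ℝ, t • (1 : A) ∈ s → 0 ≤ t := by
    rintro t ⟨c, hc, h⟩
    by_contra! ht
    rcases hc.eq_or_lt with rfl | hc
    · rw [zero_smul, add_zero] at h
      have := hM.smul_mem (c := (-t)⁻¹) (inv_nonneg.2 (by linarith)) h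
      rw [smul_smul, inv_neg, neg_mul, inv_mul_cancel₀ ht.ne, neg_one_smul] at this
      exact hneg this
    · have := hM.smul_mem (inv_nonneg.2 hc.le)
        (hM.add_mem h (hM.algebraMap_mem (neg_nonneg.2 ht.le)))
      rw [Algebra.algebraMap_eq_smul_one, neg_smul, add_comm (t • (1 : A)), add_neg_cancel_right,
        inv_smul_smul₀ hc.ne'] at this
      exact hf this
  have h1 : (1 : A) ≠ 0 := fun h => hneg (by rw [h, neg_zero]; exact hM.zero_mem)
  let f₀ : A →ₗ.[ℝ] ℝ := LinearPMap.mkSpanSingleton (1 : A) (1 : ℝ) h1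
  obtain ⟨ℓ₀, hext, hℓ₀⟩ := riesz_extension s f₀ (by
      rintro ⟨x, hx⟩ hxs
      obtain ⟨t, rfl⟩ := Submodule.mem_span_singleton.1 hx
      have e := LinearPMap.mkSpanSingleton'_apply (1 : A) (1 : ℝ)
        (fun c hc => by simpa [h1] using hc) t hx
      change 0 ≤ LinearPMap.mkSpanSingleton' (1 : A) (1 : ℝ) _ _
      rw [e]
      simpa using hs t hxs) (by
      intro y
      obtain ⟨n, hn⟩ := harch (-y)
      refine ⟨⟨n • (1 : A), Submodule.mem_span_singleton.2 ⟨n, rfl⟩⟩, 0, le_rfl, ?_⟩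
      change n • (1 : A) + y + (0 : ℝ) • f ∈ M
      rwa [zero_smul, add_zero, ← Algebra.algebraMap_eq_smul_one, ← sub_neg_eq_add])
  have hmem₀ : (ℓ₀ : A → ℝ) ∈ stateSet M := by
    refine ⟨ℓ₀.isLinear, fun m hm => hℓ₀ m ⟨0, le_rfl, by simpa using hm⟩, ?_⟩
    have := hext ⟨1, Submodule.mem_span_singleton_self 1⟩
    rw [this]
    exact LinearPMap.mkSpanSingleton_apply ℝ _ h1 _
  have hf₀ : ℓ₀ f ≤ 0 := by
    have := hℓ₀ (-f) ⟨1, zero_le_one, by simpa using hM.zero_mem⟩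
    rw [map_neg] at this
    linarith
  -- An extreme point of the face of states that minimize the value at `f`.
  let F : Set (A → ℝ) := {ℓ ∈ stateSet M | ∀ ℓ' ∈ stateSet M, ℓ f ≤ ℓ' f}
  have hcompact := isCompact_stateSet harch
  have hFext : IsExtreme ℝ (stateSet M) F := by
    refine ⟨fun ℓ h => h.1, ?_⟩
    rintro ℓ₁ h₁ ℓ₂ h₂ ℓ h ⟨a, b, ha, hb, hab, rfl⟩
    refine ⟨h₁, fun ℓ' h' => ?_⟩
    have e := h.2 ℓ₂ h₂
    have e' := h.2 ℓ' h'
    simp only [Pi.add_apply, Pi.smul_apply, smul_eq_mul] at e e'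
    obtain rfl : b = 1 - a := by linarith
    have e₁ : ℓ₁ f ≤ ℓ₂ f := by nlinarith
    nlinarith
  have hFclosed : IsClosed F := by
    have : F = stateSet M ∩ ⋂ ℓ' ∈ stateSet M, {ℓ : A → ℝ | ℓ f ≤ ℓ' f} := by
      ext ℓ; simp [F]
    rw [this]
    exact (isClosed_stateSet M).inter (isClosed_biInter fun ℓ' _ =>
      isClosed_le (continuous_apply f) continuous_const)
  have hFne : F.Nonempty := by
    obtain ⟨ℓ, h, hmin⟩ := hcompact.exists_isMinOn ⟨_, hmem₀⟩ (continuous_apply f).continuousOn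
    exact ⟨ℓ, h, fun ℓ' h' => hmin h'⟩
  obtain ⟨ℓ, hℓ⟩ := (hcompact.of_isClosed_subset hFclosed hFext.1).extremePoints_nonempty hFne
  have hℓM := hFext.extremePoints_subset_extremePoints hℓ
  have hst := hℓM.1
  refine ⟨AlgHom.ofLinearMap (IsLinearMap.mk' ℓ hst.1) hst.2.2 (hM.extreme_state_mul harch hℓM),
    hst.2.1, ?_⟩
  exact (hℓ.1.2 _ hmem₀).trans hf₀

end IsQuadraticModule

end QuadraticModule

/-! ### Putinar's Positivstellensatz -/

/-- The quadratic module generated by finitely many elements of a commutative ring. -/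
def generatedQuadraticModule {A ι : Type*} [CommRing A] [Fintype ι] (p : ι → A) : Set A :=
  {f | ∃ (σ₀ : A) (σ : ι → A), IsSumSq σ₀ ∧ (∀ i, IsSumSq (σ i)) ∧ f = σ₀ + ∑ i, σ i * p i}

lemma isQuadraticModule_generated {A ι : Type*} [CommRing A] [Fintype ι] (p : ι → A) :
    IsQuadraticModule (generatedQuadraticModule p) where
  one_mem := ⟨1, 0, by simp, fun _ => IsSumSq.zero, by simp⟩
  add_mem := by
    rintro _ _ ⟨σ₀, σ, h₀, h, rfl⟩ ⟨τ₀, τ, h₀', h', rfl⟩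
    refine ⟨σ₀ + τ₀, σ + τ, h₀.add h₀', fun i => (h i).add (h' i), ?_⟩
    simp only [Pi.add_apply, add_mul, Finset.sum_add_distrib]
    ring
  mul_self_mul_mem := by
    rintro b _ ⟨σ₀, σ, h₀, h, rfl⟩
    refine ⟨b * b * σ₀, fun i => b * b * σ i, (IsSumSq.mul_self b).mul h₀,
      fun i => (IsSumSq.mul_self b).mul (h i), ?_⟩
    simp only [mul_add, Finset.mul_sum, mul_assoc]

lemma mem_generatedQuadraticModule {A ι : Type*} [CommRing A] [Fintype ι] (p : ι → A) (i : ι) :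
    p i ∈ generatedQuadraticModule p := by
  classical
  refine ⟨0, Pi.single i 1, IsSumSq.zero, fun j => ?_, ?_⟩
  · rcases eq_or_ne j i with rfl | hj
    · simp
    · simp [hj]
  · rw [zero_add, Finset.sum_eq_single i] <;> simp +contextual

/-- **Putinar's Positivstellensatz.** If every variable is bounded modulo the quadratic module
generated by the `p i`, then a polynomial that is positive wherever all `p i` are nonnegative
lies in that quadratic module. -/
theorem putinar_positivstellensatz {τ ι : Type*} [Fintype ι] (p : ι → MvPolynomial τ ℝ)
    (hX : ∀ a, MvPolynomial.X a ∈ (isQuadraticModule_generated p).boundedElements)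
    {f : MvPolynomial τ ℝ}
    (hf : ∀ x : τ → ℝ, (∀ i, 0 ≤ MvPolynomial.eval x (p i)) → 0 < MvPolynomial.eval x f) :
    f ∈ generatedQuadraticModule p := by
  have hM := isQuadraticModule_generated p
  have htop : hM.boundedElements = ⊤ := by
    rw [eq_top_iff, ← MvPolynomial.adjoin_range_X, Algebra.adjoin_le_iff]
    rintro _ ⟨a, rfl⟩
    exact hX a
  by_contra hcon
  obtain ⟨φ, hφ, hφf⟩ := hM.exists_algHom_nonpos (fun a => by
    obtain ⟨n, hn, -⟩ := hM.mem_boundedElements.1 (htop ▸ Algebra.mem_top : a ∈ _)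
    exact ⟨n, hn⟩) hcon
  have hev : ∀ q, φ q = MvPolynomial.eval (fun a => φ (MvPolynomial.X a)) q := by
    intro q
    conv_lhs => rw [MvPolynomial.aeval_unique φ]
    rw [MvPolynomial.aeval_eq_eval]; rfl
  have := hf (fun a => φ (MvPolynomial.X a)) fun i => by
    rw [← hev]
    exact hφ _ (mem_generatedQuadraticModule p i)
  rw [← hev] at this
  linarith

/-! ### Lagrangian duality for one constraint on a compact space -/

/-- Duality for minimizing `F` subject to `c ≤ e` over mixtures of points of a compact space,
under Slater's condition `c x₀ < e`: some multiplier `l ≥ 0` has minimizers `x`, `y` of the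
Lagrangian `F + l c` of which a mixture is feasible and satisfies complementary slackness. -/
theorem exists_multiplier_of_compact {X : Type*} [TopologicalSpace X] [CompactSpace X]
    {F c : X → ℝ} (hF : Continuous F) (hc : Continuous c) {e : ℝ} {x₀ : X} (h₀ : c x₀ < e) :
    ∃ (l θ : ℝ) (x y : X), 0 ≤ l ∧ 0 ≤ θ ∧ θ ≤ 1 ∧ (∀ z, F x + l * c x ≤ F z + l * c z) ∧
      (∀ z, F y + l * c y ≤ F z + l * c z) ∧ θ * c x + (1 - θ) * c y ≤ e ∧
      l * (θ * c x + (1 - θ) * c y) = l * e := by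
  have hcont : ∀ l : ℝ, Continuous fun x => F x + l * c x := fun l => by fun_prop
  have hmin : ∀ l : ℝ, ∃ x, ∀ z, F x + l * c x ≤ F z + l * c z := by
    intro l
    obtain ⟨x, -, hx⟩ := isCompact_univ.exists_isMinOn ⟨x₀, Set.mem_univ _⟩ (hcont l).continuousOn
    exact ⟨x, fun z => hx (Set.mem_univ z)⟩
  let Z : Set (ℝ × X) := ⋂ z, {p | F p.2 + p.1 * c p.2 ≤ F z + p.1 * c z}
  have hZ : IsClosed Z := isClosed_iInter fun z => isClosed_le (by fun_prop) (by fun_prop)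
  -- Multipliers with a Lagrangian minimizer that is feasible, respectively that has cost `≥ e`.
  let S : Set ℝ := Prod.fst '' (Z ∩ {p | c p.2 ≤ e})
  let T : Set ℝ := Prod.fst '' (Z ∩ {p | e ≤ c p.2})
  have hS : IsClosed S := isClosedMap_fst_of_compactSpace _
    (hZ.inter (isClosed_le (by fun_prop) continuous_const))
  have hT : IsClosed T := isClosedMap_fst_of_compactSpace _
    (hZ.inter (isClosed_le continuous_const (by fun_prop)))
  have hne : (S ∩ Set.Ici 0).Nonempty := by
    obtain ⟨x₁, hx₁⟩ := hmin 0
    simp only [zero_mul, add_zero] at hx₁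
    have hpos : 0 < e - c x₀ := sub_pos.2 h₀
    have hq : 0 ≤ (F x₀ - F x₁) / (e - c x₀) := div_nonneg (sub_nonneg.2 (hx₁ x₀)) hpos.le
    obtain ⟨x, hx⟩ := hmin ((F x₀ - F x₁) / (e - c x₀) + 1)
    refine ⟨_, ⟨(_, x), ⟨Set.mem_iInter.2 hx, ?_⟩, rfl⟩, add_nonneg hq zero_le_one⟩
    have h₁ := hx x₀
    have h₂ := hx₁ x
    have h₃ : (F x₀ - F x₁) / (e - c x₀) * (e - c x₀) = F x₀ - F x₁ :=
      div_mul_cancel₀ _ hpos.ne'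
    change c x ≤ e
    by_contra! hcon
    set q := (F x₀ - F x₁) / (e - c x₀)
    have : (q + 1) * (e - c x₀) < (q + 1) * (c x - c x₀) :=
      mul_lt_mul_of_pos_left (by linarith) (by linarith)
    nlinarith
  have hbdd : BddBelow (S ∩ Set.Ici 0) := ⟨0, fun _ h => h.2⟩
  obtain ⟨⟨⟨l, x⟩, ⟨hxZ, hxe⟩, hl⟩, hl0⟩ := (hS.inter isClosed_Ici).csInf_mem hne hbdd
  change l = sInf (S ∩ Set.Ici 0) at hl
  rw [← hl] at hl0
  change c x ≤ e at hxe
  have hx := Set.mem_iInter.1 hxZ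
  rcases (Set.mem_Ici.1 hl0).eq_or_lt with h0 | h0
  · exact ⟨l, 1, x, x, hl0, zero_le_one, le_rfl, hx, hx, by linarith, by rw [← h0]; ring⟩
  have hsub : Set.Ico 0 l ⊆ T := by
    intro t ht
    obtain ⟨y, hy⟩ := hmin t
    refine ⟨(t, y), ⟨Set.mem_iInter.2 hy, ?_⟩, rfl⟩
    by_contra hcon
    have hle : c y ≤ e := le_of_not_ge hcon
    have : t ∈ S := ⟨(t, y), ⟨Set.mem_iInter.2 hy, hle⟩, rfl⟩
    have := csInf_le hbdd ⟨this, ht.1⟩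
    linarith [ht.2]
  have hlT : l ∈ T := by
    have := closure_minimal hsub hT
    rw [closure_Ico h0.ne] at this
    exact this (Set.right_mem_Icc.2 h0.le)
  obtain ⟨⟨l', y⟩, ⟨hyZ, hye⟩, hl'⟩ := hlT
  obtain rfl : l' = l := hl'
  change e ≤ c y at hye
  have hy := Set.mem_iInter.1 hyZ
  obtain ⟨θ, η, hθ, hη, hsum, h⟩ : e ∈ segment ℝ (c x) (c y) := by
    rw [segment_eq_Icc (hxe.trans hye)]
    exact ⟨hxe, hye⟩
  obtain rfl : η = 1 - θ := by linarith
  simp only [smul_eq_mul] at h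
  exact ⟨l', θ, x, y, hl0, hθ, by linarith, hx, hy, h.le, by rw [h]⟩

/-! ### Duality over the Wasserstein ball -/

namespace WassersteinSOS

variable {m N : ℕ} {Ξ : Set (EuclideanSpace ℝ (Fin m))}

/-- Weak duality for the worst-case expectation over a Wasserstein ball. -/
theorem dual_le_integral [CompactSpace Ξ] [NeZero N] {f : Ξ → ℝ} (hf : Continuous f)
    {ξhat : Fin N → Ξ} {ε : ℝ} (hε : 0 < ε) {Q : ProbabilityMeasure Ξ}
    (hQ : Q ∈ wassersteinBall ξhat ε) {l : ℝ} (hl : 0 ≤ l) {α : Fin N → ℝ}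
    (hα : ∀ i ξ, α i ≤ f ξ + l * ‖(ξ : EuclideanSpace ℝ (Fin m)) - ξhat i‖ ^ 2) :
    -l * ε ^ 2 + (1 / (N : ℝ)) * ∑ i, α i ≤ ∫ ξ, f ξ ∂(Q : Measure Ξ) := by
  -- The minimal Lagrangian cost of transporting mass away from `z`.
  let β : Ξ → ℝ := fun z =>
    sInf ((fun ξ : Ξ => f ξ + l * ‖(ξ : EuclideanSpace ℝ (Fin m)) - z‖ ^ 2) '' Set.univ)
  have hβc : Continuous β := by
    refine IsCompact.continuous_sInf (K := (Set.univ : Set Ξ)) isCompact_univ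
      (f := fun z ξ : Ξ => f ξ + l * ‖(ξ : EuclideanSpace ℝ (Fin m)) - z‖ ^ 2) ?_
    change Continuous fun p : Ξ × Ξ =>
      f p.2 + l * ‖(p.2 : EuclideanSpace ℝ (Fin m)) - (p.1 : EuclideanSpace ℝ (Fin m))‖ ^ 2
    fun_prop
  have hβle : ∀ z ξ : Ξ, β z ≤ f ξ + l * ‖(ξ : EuclideanSpace ℝ (Fin m)) - z‖ ^ 2 := by
    intro z ξ
    refine csInf_le (IsCompact.bddBelow (isCompact_univ.image ?_)) ⟨ξ, Set.mem_univ _, rfl⟩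
    fun_prop
  have hαβ : ∀ i, α i ≤ β (ξhat i) := fun i =>
    le_csInf ⟨_, ξhat i, Set.mem_univ _, rfl⟩ (by rintro _ ⟨ξ, -, rfl⟩; exact hα i ξ)
  have hβP : ∫ z, β z ∂(empiricalMeasure ξhat) = (1 / (N : ℝ)) * ∑ i, β (ξhat i) := by
    rw [empiricalMeasure, integral_smul_measure, integral_finsetSum_measure]
    · simp
    · exact fun i _ => integrable_dirac (by simp)
  -- The infimum over couplings need not be known to be attained: use radii `ε' > ε`.
  have key : ∀ ε' > ε, -l * ε' ^ 2 + (1 / (N : ℝ)) * ∑ i, α i ≤ ∫ ξ, f ξ ∂(Q : Measure Ξ) := by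
    intro ε' hε'
    have hε'0 : 0 < ε' := hε.trans hε'
    have hlt : wassersteinDist (Q : Measure Ξ) (empiricalMeasure ξhat) < ENNReal.ofReal ε' :=
      lt_of_le_of_lt hQ ((ENNReal.ofReal_lt_ofReal_iff hε'0).2 hε')
    simp only [wassersteinDist, iInf_lt_iff] at hlt
    obtain ⟨π, ⟨hπ, hπ₁, hπ₂⟩, hcost⟩ := hlt
    have hint : ∀ {u : Ξ × Ξ → ℝ}, Continuous u → Integrable u π := fun hu =>
      hu.integrable_of_hasCompactSupport (HasCompactSupport.of_compactSpace _)
    let c : Ξ × Ξ → ℝ := fun z => ‖(z.1 : EuclideanSpace ℝ (Fin m)) - z.2‖ ^ 2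
    have hcc : Continuous c := by fun_prop
    have hc : ∫ z, c z ∂π ≤ ε' ^ 2 := by
      rw [integral_eq_lintegral_of_nonneg_ae (Eventually.of_forall fun z => sq_nonneg _)
        hcc.aestronglyMeasurable]
      refine ENNReal.toReal_le_of_le_ofReal (by positivity) ?_
      have h := ENNReal.rpow_le_rpow hcost.le (zero_le_two (α := ℝ))
      rw [← ENNReal.rpow_mul, show (1 / 2 : ℝ) * 2 = 1 by norm_num, ENNReal.rpow_one,
        ENNReal.ofReal_rpow_of_pos hε'0, Real.rpow_two] at h
      exact h
    have hfQ : ∫ ξ, f ξ ∂(Q : Measure Ξ) = ∫ z, f z.1 ∂π := by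
      rw [← hπ₁, integral_map measurable_fst.aemeasurable hf.aestronglyMeasurable]
    have hβπ : ∫ z, β z ∂(empiricalMeasure ξhat) = ∫ z, β z.2 ∂π := by
      rw [← hπ₂, integral_map measurable_snd.aemeasurable hβc.aestronglyMeasurable]
    have hmono : ∫ z, β z.2 ∂π ≤ ∫ z, (f z.1 + l * c z) ∂π :=
      integral_mono (hint (by fun_prop)) (hint (by fun_prop)) fun z => hβle z.2 z.1
    rw [integral_add (hint (by fun_prop)) (hint (by fun_prop)), integral_const_mul, ← hfQ, ← hβπ,
      hβP] at hmono
    have h₁ : (1 / (N : ℝ)) * ∑ i, α i ≤ (1 / (N : ℝ)) * ∑ i, β (ξhat i) :=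
      mul_le_mul_of_nonneg_left (Finset.sum_le_sum fun i _ => hαβ i) (by positivity)
    have h₂ := mul_le_mul_of_nonneg_left hc hl
    linarith
  have hlim : Tendsto (fun ε' : ℝ => -l * ε' ^ 2 + (1 / (N : ℝ)) * ∑ i, α i) (𝓝[>] ε)
      (𝓝 (-l * ε ^ 2 + (1 / (N : ℝ)) * ∑ i, α i)) :=
    (Continuous.tendsto (by fun_prop) ε).mono_left nhdsWithin_le_nhds
  exact le_of_tendsto hlim (eventually_mem_nhdsWithin.mono key)

/-- Moving a proportion `θ` of each atom `ξ̂ᵢ` of the empirical distribution to `x i` and the rest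
to `y i` gives a member of the Wasserstein ball as soon as the mean squared displacement is at
most `ε²`. -/
theorem exists_mem_wassersteinBall [NeZero N] (ξhat x y : Fin N → Ξ) {ε θ : ℝ} (hε : 0 ≤ ε)
    (h0 : 0 ≤ θ) (h1 : θ ≤ 1)
    (hcost : θ * ((1 / (N : ℝ)) * ∑ i, ‖(x i : EuclideanSpace ℝ (Fin m)) - ξhat i‖ ^ 2)
      + (1 - θ) * ((1 / (N : ℝ)) * ∑ i, ‖(y i : EuclideanSpace ℝ (Fin m)) - ξhat i‖ ^ 2)
      ≤ ε ^ 2) :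
    ∃ Q ∈ wassersteinBall ξhat ε, ∀ f : Ξ → ℝ, ∫ ξ, f ξ ∂(Q : Measure Ξ)
      = θ * ((1 / (N : ℝ)) * ∑ i, f (x i)) + (1 - θ) * ((1 / (N : ℝ)) * ∑ i, f (y i)) := by
  have h1' : 0 ≤ 1 - θ := sub_nonneg.2 h1
  have hsum : ENNReal.ofReal θ + ENNReal.ofReal (1 - θ) = 1 := by
    rw [← ENNReal.ofReal_add h0 h1']; simp
  let π : Measure (Ξ × Ξ) := (N : ℝ≥0∞)⁻¹ • ∑ i, (ENNReal.ofReal θ • Measure.dirac (x i, ξhat i)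
    + ENNReal.ofReal (1 - θ) • Measure.dirac (y i, ξhat i))
  have hmap : ∀ {Y : Type} [MeasurableSpace Y] {u : Ξ × Ξ → Y}, Measurable u →
      π.map u = (N : ℝ≥0∞)⁻¹ • ∑ i, (ENNReal.ofReal θ • Measure.dirac (u (x i, ξhat i))
        + ENNReal.ofReal (1 - θ) • Measure.dirac (u (y i, ξhat i))) := by
    intro Y _ u hu
    simp only [← Measure.mapₗ_apply_of_measurable hu, π, map_smul, map_sum, map_add]
    simp only [Measure.mapₗ_apply_of_measurable hu, Measure.map_dirac' hu]
  have hπ : IsProbabilityMeasure π := by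
    constructor
    simp only [π, Measure.smul_apply, Measure.finsetSum_apply, Measure.add_apply, measure_univ,
      smul_eq_mul, mul_one, hsum, Finset.sum_const, Finset.card_univ, Fintype.card_fin,
      nsmul_eq_mul]
    exact ENNReal.inv_mul_cancel (by simpa using NeZero.ne N) (by simp)
  have hsnd : π.map Prod.snd = empiricalMeasure ξhat := by
    rw [hmap measurable_snd, empiricalMeasure]
    simp only [← add_smul, hsum, one_smul]
  refine ⟨⟨π.map Prod.fst, Measure.isProbabilityMeasure_map measurable_fst.aemeasurable⟩, ?_, ?_⟩
  · change wassersteinDist (π.map Prod.fst) (empiricalMeasure ξhat) ≤ ENNReal.ofReal ε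
    refine (iInf₂_le π ⟨hπ, rfl, hsnd⟩).trans ?_
    have e : ∫⁻ z, ENNReal.ofReal (‖(z.1 : EuclideanSpace ℝ (Fin m)) - z.2‖ ^ 2) ∂π
        = ENNReal.ofReal
          (θ * ((1 / (N : ℝ)) * ∑ i, ‖(x i : EuclideanSpace ℝ (Fin m)) - ξhat i‖ ^ 2)
          + (1 - θ) * ((1 / (N : ℝ)) * ∑ i, ‖(y i : EuclideanSpace ℝ (Fin m)) - ξhat i‖ ^ 2)) := by
      simp only [π, lintegral_smul_measure, lintegral_finsetSum_measure, lintegral_add_measure,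
        lintegral_dirac, smul_eq_mul]
      have hNi : (N : ℝ≥0∞)⁻¹ = ENNReal.ofReal (N : ℝ)⁻¹ := by
        rw [ENNReal.ofReal_inv_of_pos (Nat.cast_pos.2 (NeZero.pos N)), ENNReal.ofReal_natCast]
      have : ∀ i, ENNReal.ofReal θ
            * ENNReal.ofReal (‖(x i : EuclideanSpace ℝ (Fin m)) - ξhat i‖ ^ 2)
          + ENNReal.ofReal (1 - θ)
            * ENNReal.ofReal (‖(y i : EuclideanSpace ℝ (Fin m)) - ξhat i‖ ^ 2)
          = ENNReal.ofReal (θ * ‖(x i : EuclideanSpace ℝ (Fin m)) - ξhat i‖ ^ 2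
            + (1 - θ) * ‖(y i : EuclideanSpace ℝ (Fin m)) - ξhat i‖ ^ 2) := fun i => by
        rw [ENNReal.ofReal_add (by positivity) (by positivity), ENNReal.ofReal_mul h0,
          ENNReal.ofReal_mul h1']
      simp only [this]
      rw [← ENNReal.ofReal_sum_of_nonneg fun i _ => by positivity, hNi,
        ← ENNReal.ofReal_mul (by positivity), Finset.sum_add_distrib, ← Finset.mul_sum,
        ← Finset.mul_sum]
      congr 1
      ring
    rw [e]
    refine (ENNReal.rpow_le_rpow (ENNReal.ofReal_le_ofReal hcost) (by norm_num)).trans_eq ?_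
    rw [ENNReal.ofReal_rpow_of_nonneg (by positivity) (by norm_num), ← Real.sqrt_eq_rpow,
      Real.sqrt_sq hε]
  · intro f
    change ∫ ξ, f ξ ∂(π.map Prod.fst) = _
    have hd : ∀ z : Ξ, Integrable f (Measure.dirac z) := fun z => integrable_dirac (by simp)
    rw [hmap measurable_fst, integral_smul_measure, integral_finsetSum_measure fun i _ =>
      ((hd _).smul_measure ENNReal.ofReal_ne_top).add_measure
        ((hd _).smul_measure ENNReal.ofReal_ne_top)]
    simp only [integral_add_measure ((hd _).smul_measure ENNReal.ofReal_ne_top)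
      ((hd _).smul_measure ENNReal.ofReal_ne_top), integral_smul_measure, integral_dirac,
      ENNReal.toReal_ofReal h0, ENNReal.toReal_ofReal h1', smul_eq_mul, Finset.sum_add_distrib,
      ← Finset.mul_sum, ENNReal.toReal_inv, ENNReal.toReal_natCast]
    ring

/-- Strong duality over the Wasserstein ball: the worst-case expectation is attained and equals
the value of a dual point `(l, α)`. -/
theorem exists_primal_dual_optimal [CompactSpace Ξ] [NeZero N] {f : Ξ → ℝ} (hf : Continuous f)
    (ξhat : Fin N → Ξ) {ε : ℝ} (hε : 0 < ε) :
    ∃ Q ∈ wassersteinBall ξhat ε, ∃ (l : ℝ) (α : Fin N → ℝ), 0 ≤ l ∧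
      (∀ i ξ, α i ≤ f ξ + l * ‖(ξ : EuclideanSpace ℝ (Fin m)) - ξhat i‖ ^ 2) ∧
      ∫ ξ, f ξ ∂(Q : Measure Ξ) = -l * ε ^ 2 + (1 / (N : ℝ)) * ∑ i, α i := by
  let F : (Fin N → Ξ) → ℝ := fun x => (1 / (N : ℝ)) * ∑ i, f (x i)
  let c : (Fin N → Ξ) → ℝ := fun x =>
    (1 / (N : ℝ)) * ∑ i, ‖(x i : EuclideanSpace ℝ (Fin m)) - ξhat i‖ ^ 2
  have hN : 0 < 1 / (N : ℝ) := one_div_pos.2 (Nat.cast_pos.2 (NeZero.pos N))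
  obtain ⟨l, θ, x, y, hl, h0, h1, hx, hy, hle, hslack⟩ :=
    exists_multiplier_of_compact (F := F) (c := c) (e := ε ^ 2) (x₀ := ξhat) (by fun_prop)
      (by fun_prop) (by simp only [c, sub_self]; simpa using pow_pos hε 2)
  obtain ⟨Q, hQ, hint⟩ := exists_mem_wassersteinBall ξhat x y hε.le h0 h1 hle
  have hFc : ∀ z, F z + l * c z = (1 / (N : ℝ)) *
      ∑ i, (f (z i) + l * ‖(z i : EuclideanSpace ℝ (Fin m)) - ξhat i‖ ^ 2) := by
    intro z
    simp only [F, c, Finset.sum_add_distrib, ← Finset.mul_sum]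
    ring
  refine ⟨Q, hQ, l, fun i => f (x i) + l * ‖(x i : EuclideanSpace ℝ (Fin m)) - ξhat i‖ ^ 2, hl,
    fun i ξ => ?_, ?_⟩
  · -- A minimizer of the separable Lagrangian minimizes every summand.
    have h := hx (Function.update x i ξ)
    rw [hFc, hFc] at h
    have h := le_of_mul_le_mul_left h hN
    rw [← Finset.add_sum_erase _ _ (Finset.mem_univ i),
      ← Finset.add_sum_erase Finset.univ (fun j => f (Function.update x i ξ j) +
        l * ‖(Function.update x i ξ j : EuclideanSpace ℝ (Fin m)) - ξhat j‖ ^ 2)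
        (Finset.mem_univ i), Function.update_self] at h
    have e : ∑ j ∈ Finset.univ.erase i, (f (Function.update x i ξ j) +
        l * ‖(Function.update x i ξ j : EuclideanSpace ℝ (Fin m)) - ξhat j‖ ^ 2)
        = ∑ j ∈ Finset.univ.erase i,
          (f (x j) + l * ‖(x j : EuclideanSpace ℝ (Fin m)) - ξhat j‖ ^ 2) :=
      Finset.sum_congr rfl fun j hj => by
        rw [Function.update_of_ne (Finset.ne_of_mem_erase hj)]
    rw [e] at h
    linarith
  · rw [hint, ← hFc]
    have hxy : F x + l * c x = F y + l * c y := le_antisymm (hx y) (hy x)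
    change θ * F x + (1 - θ) * F y = _
    linear_combination (θ - 1) * hxy - hslack

end WassersteinSOS

namespace WassersteinSOS

variable {m L K J N : ℕ}

/-! ### The support set and the lifted constraints -/

lemma isSumSq_map {A B : Type*} [CommRing A] [CommRing B] {φ : Type*} [FunLike φ A B]
    [RingHomClass φ A B] (u : φ) {a : A} (ha : IsSumSq a) : IsSumSq (u a) := by
  induction ha with
  | zero => simp
  | sq_add a _ ih =>
    rw [map_add, map_mul]
    exact (IsSumSq.mul_self _).add ih

lemma eval_nonneg_of_isSumSq {τ : Type*} {p : MvPolynomial τ ℝ} (hp : IsSumSq p) (x : τ → ℝ) :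
    0 ≤ MvPolynomial.eval x p :=
  (isSumSq_map (MvPolynomial.eval x) hp).nonneg

lemma compactSpace_supportSet {h : Fin L → MvPolynomial (Fin m) ℝ} (harch : IsArchimedean h) :
    CompactSpace (supportSet h) := by
  rw [← isCompact_iff_compactSpace]
  have hclosed : IsClosed (supportSet h) := by
    simp only [supportSet, Set.ofPred_forall]
    refine isClosed_iInter fun l => isClosed_le continuous_const ?_
    exact (MvPolynomial.continuous_eval (h l)).comp (PiLp.continuous_ofLp 2 _)
  obtain ⟨R, σ₀, σ, h₀, hσ, e⟩ := harch
  refine (isCompact_closedBall (0 : EuclideanSpace ℝ (Fin m)) (Real.sqrt R)).of_isClosed_subset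
    hclosed fun ξ hξ => ?_
  rw [mem_closedBall_zero_iff]
  refine Real.le_sqrt_of_sq_le ?_
  have h₁ := congrArg (MvPolynomial.eval ξ.ofLp) e
  simp only [map_sub, map_add, map_sum, map_mul, map_pow, MvPolynomial.eval_C,
    MvPolynomial.eval_X] at h₁
  have h₂ : 0 ≤ ∑ l, MvPolynomial.eval ξ.ofLp (σ l) * MvPolynomial.eval ξ.ofLp (h l) :=
    Finset.sum_nonneg fun l _ => mul_nonneg (eval_nonneg_of_isSumSq (hσ l) _) (hξ l)
  have h₃ := eval_nonneg_of_isSumSq h₀ ξ.ofLp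
  rw [EuclideanSpace.real_norm_sq_eq]
  linarith

lemma continuous_piecewisePoly [NeZero K] [NeZero J] (g : Fin K → Fin J → MvPolynomial (Fin m) ℝ) :
    Continuous (piecewisePoly g) := by
  unfold piecewisePoly
  refine Continuous.finset_inf'_apply _ fun k _ => Continuous.finset_sup'_apply _ fun j _ => ?_
  exact (MvPolynomial.continuous_eval (g k j)).comp (PiLp.continuous_ofLp 2 _)

lemma eval_lift (x : Option (Fin m) → ℝ) (p : MvPolynomial (Fin m) ℝ) :
    MvPolynomial.eval x (lift p) = MvPolynomial.eval (fun a => x (some a)) p := by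
  rw [lift, MvPolynomial.eval_rename]; rfl

lemma forall_eval_gTilde_nonneg {g : Fin J → MvPolynomial (Fin m) ℝ} {τ₁ τ₂ : ℝ}
    {x : Option (Fin m) → ℝ} :
    (∀ j, 0 ≤ MvPolynomial.eval x (gTilde g τ₁ τ₂ j)) ↔
      (∀ j, MvPolynomial.eval (fun a => x (some a)) (g j) ≤ x none) ∧ x none ≤ τ₁ ∧
        τ₂ ≤ x none := by
  simp only [gTilde, Fin.forall_fin_add, Fin.append_left, Fin.append_right, Fin.forall_fin_two,
    Matrix.cons_val_zero, Matrix.cons_val_one, map_sub, MvPolynomial.eval_X, MvPolynomial.eval_C,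
    eval_lift, sub_nonneg]

/-- The evaluation of the sum-of-squares constraint without its multiplier terms. -/
lemma eval_lagrangian (l α : ℝ) (z ξ : EuclideanSpace ℝ (Fin m)) {x : Option (Fin m) → ℝ}
    (hx : ∀ a, x (some a) = ξ a) :
    MvPolynomial.eval x (psi + MvPolynomial.C l * phi z - MvPolynomial.C α)
      = x none + l * ‖ξ - z‖ ^ 2 - α := by
  rw [EuclideanSpace.real_norm_sq_eq]
  simp [psi, phi, hx]

/-! ### Soundness of the hierarchy -/

theorem ADPoint.IsFeasible.mono {h : Fin L → MvPolynomial (Fin m) ℝ}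
    {g : Fin K → Fin J → MvPolynomial (Fin m) ℝ} {τ₁ τ₂ : Fin K → ℝ}
    {ξhat : Fin N → supportSet h} {r s : ℕ} (hrs : r ≤ s) {p : ADPoint m L K J N}
    (hp : p.IsFeasible h g τ₁ τ₂ ξhat r) : p.IsFeasible h g τ₁ τ₂ ξhat s where
  lam_nonneg := hp.lam_nonneg
  σ_sos := hp.σ_sos
  η_sos := hp.η_sos
  certificate_sos := hp.certificate_sos
  certificate_deg k i := (hp.certificate_deg k i).trans (by lia)
  σ_deg k i l := (hp.σ_deg k i l).trans (by lia)
  η_deg k i j := (hp.η_deg k i j).trans (by lia)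

/-- A feasible point is a feasible point of the Lagrangian dual: its sum-of-squares constraint for
the index `k` attaining the minimum is evaluated at `ξ̃ = min_k max_j g_j^{(k)}(ξ)`. -/
theorem ADPoint.IsFeasible.le_lagrangian [NeZero K] [NeZero J]
    {h : Fin L → MvPolynomial (Fin m) ℝ}
    {g : Fin K → Fin J → MvPolynomial (Fin m) ℝ} {τ₁ τ₂ : Fin K → ℝ}
    {ξhat : Fin N → supportSet h} {r : ℕ} {p : ADPoint m L K J N}
    (hτ₁ : ∀ k j, ∀ ξ ∈ supportSet h, MvPolynomial.eval ξ.ofLp (g k j) < τ₁ k)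
    (hτ₂ : ∀ k j, ∀ ξ ∈ supportSet h, τ₂ k < MvPolynomial.eval ξ.ofLp (g k j))
    (hp : p.IsFeasible h g τ₁ τ₂ ξhat r) (i : Fin N) (ξ : supportSet h) :
    p.α i ≤ piecewisePoly g (ξ : EuclideanSpace ℝ (Fin m))
      + p.lam * ‖(ξ : EuclideanSpace ℝ (Fin m)) - ξhat i‖ ^ 2 := by
  obtain ⟨k, -, hk⟩ := Finset.exists_mem_eq_inf' (Finset.univ_nonempty (α := Fin K))
    fun k => Finset.univ.sup' Finset.univ_nonempty fun j : Fin J =>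
      MvPolynomial.eval ξ.1.ofLp (g k j)
  change piecewisePoly g ξ.1 = _ at hk
  obtain ⟨j₀, -, hj₀⟩ := Finset.exists_mem_eq_sup' (Finset.univ_nonempty (α := Fin J))
    fun j => MvPolynomial.eval ξ.1.ofLp (g k j)
  set t := piecewisePoly g ξ.1
  rw [hj₀] at hk
  let x : Option (Fin m) → ℝ := fun o => o.elim t ξ.1.ofLp
  have hg : ∀ j, 0 ≤ MvPolynomial.eval x (gTilde (g k) (τ₁ k) (τ₂ k) j) := by
    refine forall_eval_gTilde_nonneg.2 ⟨fun j => ?_, ?_, ?_⟩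
    · change MvPolynomial.eval ξ.1.ofLp (g k j) ≤ t
      rw [hk, ← hj₀]
      exact Finset.le_sup' (fun j => MvPolynomial.eval ξ.1.ofLp (g k j)) (Finset.mem_univ j)
    · change t ≤ τ₁ k
      rw [hk]
      exact (hτ₁ k j₀ _ ξ.2).le
    · change τ₂ k ≤ t
      rw [hk]
      exact (hτ₂ k j₀ _ ξ.2).le
  have hcert := eval_nonneg_of_isSumSq (hp.certificate_sos k i) x
  rw [certificate, map_sub, map_sub, eval_lagrangian (ξ := ξ.1) (hx := fun a => rfl), map_sum,
    map_sum] at hcert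
  have h₁ : 0 ≤ ∑ l, MvPolynomial.eval x (p.σ k i l * lift (h l)) :=
    Finset.sum_nonneg fun l _ => by
      rw [map_mul, eval_lift]
      exact mul_nonneg (eval_nonneg_of_isSumSq (hp.σ_sos k i l) _) (ξ.2 l)
  have h₂ : 0 ≤ ∑ j, MvPolynomial.eval x (p.η k i j * gTilde (g k) (τ₁ k) (τ₂ k) j) :=
    Finset.sum_nonneg fun j _ => by
      rw [map_mul]
      exact mul_nonneg (eval_nonneg_of_isSumSq (hp.η_sos k i j) _) (hg j)
  change 0 ≤ t + _ - _ - _ - _ at hcert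
  linarith

/-! ### Completeness of the hierarchy -/

/-- The quadratic module of the lifted constraints inherits the Archimedean property: the `ξ_a`
are bounded by the Archimedean condition on `h`, and `ξ̃` lies between `τ₂` and `τ₁`. -/
lemma X_mem_boundedElements {h : Fin L → MvPolynomial (Fin m) ℝ} (harch : IsArchimedean h)
    (g : Fin J → MvPolynomial (Fin m) ℝ) (τ₁ τ₂ : ℝ) (o : Option (Fin m)) :
    MvPolynomial.X o ∈ (isQuadraticModule_generated
      (Sum.elim (fun l => lift (h l)) (gTilde g τ₁ τ₂))).boundedElements := by
  set p : Fin L ⊕ Fin (J + 2) → LiftedPoly m := Sum.elim (fun l => lift (h l)) (gTilde g τ₁ τ₂)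
    with hp
  have hM := isQuadraticModule_generated p
  rcases o with _ | a
  · have h₁ := mem_generatedQuadraticModule p (Sum.inr (Fin.natAdd J 0))
    have h₂ := mem_generatedQuadraticModule p (Sum.inr (Fin.natAdd J 1))
    simp only [hp, Sum.elim_inr, gTilde, Fin.append_right, Matrix.cons_val_zero,
      Matrix.cons_val_one] at h₁ h₂
    exact hM.mem_boundedElements_of_le_of_le h₂ h₁
  · obtain ⟨R, σ₀, σ, h₀, hσ, e⟩ := harch
    have hR : lift (MvPolynomial.C (R : ℝ) - ∑ b, MvPolynomial.X b ^ 2)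
        ∈ generatedQuadraticModule p := by
      refine ⟨lift σ₀, Sum.elim (fun l => lift (σ l)) 0, isSumSq_map _ h₀, ?_, ?_⟩
      · rintro (l | j)
        · exact isSumSq_map _ (hσ l)
        · exact IsSumSq.zero
      · rw [e]
        simp [hp, lift, Fintype.sum_sum_type]
    have hsq : ∑ b ∈ Finset.univ.erase a, (MvPolynomial.X (some b) : LiftedPoly m) ^ 2
        ∈ generatedQuadraticModule p := by
      refine Finset.sum_induction _ (· ∈ generatedQuadraticModule p)
        (fun _ _ => hM.add_mem) hM.zero_mem fun b _ => ?_
      rw [sq]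
      exact hM.mul_self_mem _
    refine hM.mem_boundedElements_of_sub_mul_self_mem (n := R) ?_
    convert hM.add_mem hR hsq using 1
    simp only [lift, map_sub, map_sum, map_pow, MvPolynomial.rename_C, MvPolynomial.rename_X,
      MvPolynomial.algebraMap_eq]
    rw [← Finset.add_sum_erase _ _ (Finset.mem_univ a)]
    ring

/-- A point of the Lagrangian dual with strict inequalities becomes feasible at all sufficiently
high levels of the hierarchy, by Putinar's Positivstellensatz. -/
theorem eventually_isFeasible [NeZero K] [NeZero J] {h : Fin L → MvPolynomial (Fin m) ℝ}
    (harch : IsArchimedean h) (g : Fin K → Fin J → MvPolynomial (Fin m) ℝ) (τ₁ τ₂ : Fin K → ℝ)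
    (ξhat : Fin N → supportSet h) {l : ℝ} (hl : 0 ≤ l) {α : Fin N → ℝ}
    (hα : ∀ i (ξ : supportSet h), α i < piecewisePoly g (ξ : EuclideanSpace ℝ (Fin m))
      + l * ‖(ξ : EuclideanSpace ℝ (Fin m)) - ξhat i‖ ^ 2) :
    ∃ p : ADPoint m L K J N, p.lam = l ∧ p.α = α ∧
      ∀ᶠ r in atTop, p.IsFeasible h g τ₁ τ₂ ξhat r := by
  have key : ∀ k i, psi + MvPolynomial.C l * phi (ξhat i : EuclideanSpace ℝ (Fin m))
      - MvPolynomial.C (α i) ∈ generatedQuadraticModule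
        (Sum.elim (fun l => lift (h l)) (gTilde (g k) (τ₁ k) (τ₂ k))) := by
    intro k i
    refine putinar_positivstellensatz _ (X_mem_boundedElements harch _ _ _) fun x hx => ?_
    let ξ : EuclideanSpace ℝ (Fin m) := WithLp.toLp 2 fun a => x (some a)
    have hξ : ξ ∈ supportSet h := fun l => by
      have := hx (Sum.inl l)
      rwa [Sum.elim_inl, eval_lift] at this
    have hg := (forall_eval_gTilde_nonneg.1 fun j => hx (Sum.inr j)).1
    have hle : piecewisePoly g ξ ≤ x none :=
      (Finset.inf'_le _ (Finset.mem_univ k)).trans (Finset.sup'_le _ _ fun j _ => hg j)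
    rw [eval_lagrangian (ξ := ξ) (hx := fun a => rfl)]
    have := hα i ⟨ξ, hξ⟩
    linarith
  choose σ₀ σ h₀ hσ e using key
  let p : ADPoint m L K J N := ⟨l, α, fun k i l => σ k i (Sum.inl l), fun k i j => σ k i (Sum.inr j)⟩
  have hcert : ∀ k i, p.certificate h g τ₁ τ₂ ξhat k i = σ₀ k i := by
    intro k i
    rw [ADPoint.certificate]
    change psi + MvPolynomial.C l * _ - MvPolynomial.C (α i) - _ - _ = _
    rw [e k i, Fintype.sum_sum_type]
    simp only [Sum.elim_inl, Sum.elim_inr, p]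
    ring
  have hdeg : ∀ q : LiftedPoly m, ∀ᶠ r : ℕ in atTop, q.totalDegree ≤ 2 * r := fun q =>
    (eventually_ge_atTop q.totalDegree).mono fun r hr => by lia
  refine ⟨p, rfl, rfl, ?_⟩
  have h₁ := eventually_all.2 fun k => eventually_all.2 fun i => hdeg (σ₀ k i)
  have h₂ := eventually_all.2 fun k => eventually_all.2 fun i => eventually_all.2 fun l =>
    hdeg (p.σ k i l * lift (h l))
  have h₃ := eventually_all.2 fun k => eventually_all.2 fun i => eventually_all.2 fun j =>
    hdeg (p.η k i j * gTilde (g k) (τ₁ k) (τ₂ k) j)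
  filter_upwards [h₁, h₂, h₃] with r h₁ h₂ h₃
  exact ⟨hl, fun k i l => hσ k i _, fun k i j => hσ k i _, fun k i => hcert k i ▸ h₀ k i,
    fun k i => hcert k i ▸ h₁ k i, h₂, h₃⟩

end WassersteinSOS

/-! ### Convergence of the hierarchy -/

theorem theorem3p2 {m L K J N : ℕ} [NeZero K] [NeZero J] [NeZero N]
    (h : Fin L → MvPolynomial (Fin m) ℝ)
    (g : Fin K → Fin J → MvPolynomial (Fin m) ℝ)
    (τ₁ τ₂ : Fin K → ℝ)
    (ξhat : Fin N → WassersteinSOS.supportSet h) (ε : ℝ)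
    (hconv : Convex ℝ (WassersteinSOS.supportSet h))
    (harch : WassersteinSOS.IsArchimedean h)
    (hτ₁ : ∀ k j, ∀ ξ ∈ WassersteinSOS.supportSet h, MvPolynomial.eval ξ.ofLp (g k j) < τ₁ k)
    (hτ₂ : ∀ k j, ∀ ξ ∈ WassersteinSOS.supportSet h, τ₂ k < MvPolynomial.eval ξ.ofLp (g k j))
    (hε : 0 < ε) :
    ∃ v : ℝ,
      IsLeast
        ((fun Q : ProbabilityMeasure (WassersteinSOS.supportSet h) =>
            ∫ ξ, WassersteinSOS.piecewisePoly g (ξ : EuclideanSpace ℝ (Fin m))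
              ∂(Q : Measure (WassersteinSOS.supportSet h))) ''
          WassersteinSOS.wassersteinBall ξhat ε) v ∧
      (∀ r : ℕ,
        WassersteinSOS.valAD h g τ₁ τ₂ ξhat ε r ≤ WassersteinSOS.valAD h g τ₁ τ₂ ξhat ε (r + 1) ∧
        WassersteinSOS.valAD h g τ₁ τ₂ ξhat ε (r + 1) ≤ (v : EReal)) ∧
      Tendsto (fun r : ℕ => WassersteinSOS.valAD h g τ₁ τ₂ ξhat ε r) atTop (𝓝 (v : EReal)) := by
  open WassersteinSOS in
  have := compactSpace_supportSet harch
  have hf : Continuous fun ξ : supportSet h => piecewisePoly g (ξ : EuclideanSpace ℝ (Fin m)) :=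
    (continuous_piecewisePoly g).comp continuous_subtype_val
  obtain ⟨Q, hQ, l, α, hl, hα, hQα⟩ := exists_primal_dual_optimal hf ξhat hε
  have hub : ∀ r, valAD h g τ₁ τ₂ ξhat ε r
      ≤ ((∫ ξ, piecewisePoly g (ξ : EuclideanSpace ℝ (Fin m)) ∂(Q : Measure (supportSet h)) : ℝ)
        : EReal) := by
    intro r
    refine sSup_le ?_
    rintro _ ⟨p, hp, rfl⟩
    exact EReal.coe_le_coe_iff.2
      (dual_le_integral hf hε hQ hp.lam_nonneg (hp.le_lagrangian hτ₁ hτ₂))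
  refine ⟨_, ⟨⟨Q, hQ, rfl⟩, ?_⟩, fun r => ⟨?_, hub _⟩, tendsto_order.2 ⟨fun a ha => ?_,
    fun a ha => Eventually.of_forall fun r => (hub r).trans_lt ha⟩⟩
  · rintro _ ⟨Q', hQ', rfl⟩
    exact hQα.trans_le (dual_le_integral hf hε hQ' hl hα)
  · exact sSup_le_sSup (Set.image_mono fun p hp => hp.mono r.le_succ)
  · -- Lowering all `αᵢ` by `δ` lowers the objective by `δ` and makes the inequalities strict.
    obtain ⟨b, hab, hb⟩ := EReal.lt_iff_exists_real_btwn.1 ha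
    have hb := EReal.coe_lt_coe_iff.1 hb
    set v := ∫ ξ, piecewisePoly g (ξ : EuclideanSpace ℝ (Fin m)) ∂(Q : Measure (supportSet h))
    obtain ⟨p, hpl, hpα, hp⟩ := eventually_isFeasible harch g τ₁ τ₂ ξhat hl
      (α := fun i => α i - (v - b)) fun i ξ => by linarith [hα i ξ]
    have hobj : p.objective ε = b := by
      have hN : (N : ℝ) ≠ 0 := Nat.cast_ne_zero.2 (NeZero.ne N)
      rw [ADPoint.objective, hpl, hpα, Finset.sum_sub_distrib, mul_sub, ← add_sub_assoc, ← hQα]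
      simp only [Finset.sum_const, Finset.card_univ, Fintype.card_fin, nsmul_eq_mul]
      field_simp
      ring
    filter_upwards [hp] with r hr
    refine hab.trans_le (le_sSup ⟨p, hr, ?_⟩)
    simp only [hobj]
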